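/- **Setting.** Let $d=JN$ with $1\le J<d$, and let the coordinates of $\mathbb{R}^d$ be divided into $J$ blocks of equal size $N=d/J$: $U=[U^{(1)},\dots,U^{(J)}]$ is a $d\times d$ permutation matrix with $U^{(j)}\in\mathbb{R}^{d\times N}$. For $f:\mathbb{R}^d\to\mathbb{R}$ with gradient $g=\nabla f$, let $g^{(j)}(x)\in\mathbb{R}^{N}$ be the part of $g(x)$ in block $j$ and $\nabla^2_{jj}f(x)$ the $j$-th block of the Hessian; $\|v\|_0$ is the number of nonzero entries of $v$. Let $\mathcal{X}\subseteq\mathbb{R}^d$ and assume: 1. (block Lipschitz) $f$ is continuously differentiable and there are constants $L_1,\dots,L_J$ with $\|g^{(j)}(x)-g^{(j)}(x+U^{(j)}t)\|_2\le L_j\|t\|_2$ for all $j$, $x\in\mathcal{X}$, $t\in\mathbb{R}^{N}$; 2. (sparse gradients) there is an integer $0<s_{\mathrm{exact}}<d$ with $\|g(x)\|_0\le s_{\mathrm{exact}}$ for all $x\in\mathbb{R}^d$; 3. (weakly sparse block Hessian) $f$ is twice differentiable and there is $H>0$ with $\sum_{k,l}|(\nabla^2_{jj}f(x))_{kl}|\le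 H$ for all $j$ and $x\in\mathcal{X}$. The values of $f$ are available only through a noisy oracle: each call at a point $u$ returns $E_f(u)=f(u)+\xi$ with a noise satisfying $|\xi|\le\sigma$ almost surely, $\sigma>0$; the noise may differ from call to call and may depend on everything else. **Block gradient estimator.** Given $x$, $j$, $s$, $\delta>0$, $n$ and directions $z_1,\dots,z_m\in\mathbb{R}^{N}$, let $Z\in\mathbb{R}^{m\times N}$ have rows $z_i^\top/\sqrt m$, let $y_i=\bigl(E_f(x+\delta U^{(j)}z_i)-E_f(x)\bigr)/(\sqrt m\,\delta)$, and let $\hat g^{(j)}=a^n$ be the result of $n$ CoSaMP iterations: $a^0=0$, and $a^{k+1}$ is obtained from $a^k$ by taking a best $2s$-sparse approximation $p$ of $Z^\top(y-Za^k)$, a minimizer $b$ of $\|Zc-y\|_2$ over all $c$ supported in $\operatorname{supp}(p)\cup\operatorname{supp}(a^k)$, and a best $s$-sparse approximation $a^{k+1}$ of $b$ (ties broken arbitrarily). **Theorem.** There are absolute constants $\rho\in(0,1)$ and $\tau,b_0,c>0$ such that the following holds in every such setting. Let $s\ge s_{\mathrm{exact}}$ be an integer, let $b_1\ge b_0$ and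 $b_2>0$ satisfy $$b_2\log(d/s)\le c\,b_1\log(d/J)$$ (for $J\le s$, in particular, every $b_2\le c\,b_1$ is allowed), let $\delta=2\sqrt{\sigma/H}$ and $m=\lceil b_1 s\log(d/J)\rceil$, let $z_1,\dots,z_m$ be independent Rademacher vectors in $\mathbb{R}^{N}$ (independent entries $\pm1$ with probability $1/2$ each), and let $n\ge0$. Fix $j$ and a point $x$ such that the segment from $x$ to $x+\delta U^{(j)}\varepsilon$ lies in $\mathcal{X}$ for every $\varepsilon\in\{-1,1\}^{N}$ (no condition if $\mathcal{X}=\mathbb{R}^d$). Then with probability at least $1-(s/d)^{b_2 s}$, $$\|\hat g^{(j)}-g^{(j)}(x)\|_2\le\rho^n\|g^{(j)}(x)\|_2+2\tau\sqrt{\sigma H}.$$ -/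

import Mathlib

open MeasureTheory ProbabilityTheory
open scoped Matrix Gradient

noncomputable section

namespace BlockGrad

/-! ### Sparse vectors and CoSaMP -/

/-- The support of a vector. -/
def supp {N : ℕ} (v : EuclideanSpace ℝ (Fin N)) : Finset (Fin N) :=
  Finset.univ.filter fun i => v i ≠ 0

/-- The number `‖v‖₀` of nonzero entries. -/
def l0 {N : ℕ} (v : EuclideanSpace ℝ (Fin N)) : ℕ := (supp v).card

/-- `w` is a best `k`-sparse approximation of `v`, that is, `v` restricted to `k` entries of largest
magnitude (ties may be broken in any way). -/
def IsBestSparseApprox {N : ℕ} (k : ℕ) (v w : EuclideanSpace ℝ (Fin N)) : Prop :=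
  l0 w ≤ k ∧ ∀ u : EuclideanSpace ℝ (Fin N), l0 u ≤ k → ‖v - w‖ ≤ ‖v - u‖

/-- `b` solves the least squares problem `min ‖Z c - y‖₂` over the vectors `c` supported in `T`.
When the columns of `Z` indexed by `T` are independent it is the unique such vector, given on `T` by
the pseudo-inverse of `Z_T` applied to `y`. -/
def IsLeastSquaresOn {m N : ℕ} (Z : Matrix (Fin m) (Fin N) ℝ) (y : EuclideanSpace ℝ (Fin m))
    (T : Finset (Fin N)) (b : EuclideanSpace ℝ (Fin N)) : Prop :=
  supp b ⊆ T ∧ ∀ c : EuclideanSpace ℝ (Fin N), supp c ⊆ T →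
    ‖Z.toEuclideanLin b - y‖ ≤ ‖Z.toEuclideanLin c - y‖

/-- One iteration of CoSaMP with target sparsity `s`, from the iterate `a` to the iterate `a'`:
form the proxy `Zᵀ (y - Z a)`, identify its `2s` largest entries `p`, merge their support with that
of `a`, solve least squares on the merged support, and prune to the `s` largest entries. -/
def CoSaMPStep {m N : ℕ} (Z : Matrix (Fin m) (Fin N) ℝ) (y : EuclideanSpace ℝ (Fin m)) (s : ℕ)
    (a a' : EuclideanSpace ℝ (Fin N)) : Prop :=
  ∃ p b : EuclideanSpace ℝ (Fin N),
    IsBestSparseApprox (2 * s) (Zᵀ.toEuclideanLin (y - Z.toEuclideanLin a)) p ∧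
    IsLeastSquaresOn Z y (supp p ∪ supp a) b ∧
    IsBestSparseApprox s b a'

/-- `g` is a result of `n` iterations of CoSaMP started at `0`. -/
def IsCoSaMPOutput {m N : ℕ} (Z : Matrix (Fin m) (Fin N) ℝ) (y : EuclideanSpace ℝ (Fin m))
    (s n : ℕ) (g : EuclideanSpace ℝ (Fin N)) : Prop :=
  ∃ a : ℕ → EuclideanSpace ℝ (Fin N),
    a 0 = 0 ∧ (∀ k < n, CoSaMPStep Z y s (a k) (a (k + 1))) ∧ a n = g

/-! ### Blocks and the objective function -/

/-- A division of the `d` coordinates into `J` blocks of `N` coordinates is a bijection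
`e : Fin J × Fin N ≃ Fin d` (a permutation matrix `U` cut into `J` submatrices of `N` columns each);
`blockMatrix e j` is the `d × N` matrix `U⁽ʲ⁾` whose `k`-th column is the basis vector
numbered `e (j, k)`. -/
def blockMatrix {d J N : ℕ} (e : Fin J × Fin N ≃ Fin d) (j : Fin J) :
    Matrix (Fin d) (Fin N) ℝ :=
  Matrix.of fun i k => if i = e (j, k) then 1 else 0

/-- The vector `U⁽ʲ⁾ t`. -/
def embed {d J N : ℕ} (e : Fin J × Fin N ≃ Fin d) (j : Fin J) (t : EuclideanSpace ℝ (Fin N)) :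
    EuclideanSpace ℝ (Fin d) :=
  (blockMatrix e j).toEuclideanLin t

/-- The block gradient `g⁽ʲ⁾(x)`, as a vector of length `N`. -/
def blockGradient {d J N : ℕ} (e : Fin J × Fin N ≃ Fin d) (f : EuclideanSpace ℝ (Fin d) → ℝ)
    (j : Fin J) (x : EuclideanSpace ℝ (Fin d)) : EuclideanSpace ℝ (Fin N) :=
  WithLp.toLp 2 fun k => (∇ f x) (e (j, k))

/-- The `j`-th block Hessian `∇²_{jj} f(x)`. -/
def blockHessian {d J N : ℕ} (e : Fin J × Fin N ≃ Fin d) (f : EuclideanSpace ℝ (Fin d) → ℝ)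
    (j : Fin J) (x : EuclideanSpace ℝ (Fin d)) : Matrix (Fin N) (Fin N) ℝ :=
  Matrix.of fun k l =>
    (fderiv ℝ (fun u => ∇ f u) x (EuclideanSpace.single (e (j, l)) 1)) (e (j, k))

/-- Block Lipschitz differentiability on `X`, with constants `L j`. -/
def BlockLipschitz {d J N : ℕ} (e : Fin J × Fin N ≃ Fin d) (X : Set (EuclideanSpace ℝ (Fin d)))
    (f : EuclideanSpace ℝ (Fin d) → ℝ) (L : Fin J → ℝ) : Prop :=
  ContDiff ℝ 1 f ∧ ∀ j, ∀ x ∈ X, ∀ t : EuclideanSpace ℝ (Fin N),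
    ‖blockGradient e f j x - blockGradient e f j (x + embed e j t)‖ ≤ L j * ‖t‖

/-- All gradients of `f` are `sExact`-sparse, with `0 < sExact < d`. -/
def SparseGradients {d : ℕ} (f : EuclideanSpace ℝ (Fin d) → ℝ) (sExact : ℕ) : Prop :=
  0 < sExact ∧ sExact < d ∧ ∀ x, l0 (∇ f x) ≤ sExact

/-- `f` is twice differentiable and on `X` the entrywise `ℓ¹` norms of the block Hessians are at
most `H`. -/
def WeaklySparseBlockHessian {d J N : ℕ} (e : Fin J × Fin N ≃ Fin d)
    (X : Set (EuclideanSpace ℝ (Fin d))) (f : EuclideanSpace ℝ (Fin d) → ℝ) (H : ℝ) : Prop :=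
  Differentiable ℝ f ∧ Differentiable ℝ (fun u => ∇ f u) ∧
    ∀ j, ∀ x ∈ X, ∑ k, ∑ l, |blockHessian e f j x k l| ≤ H

/-! ### The block gradient estimator -/

/-- The measurement matrix with rows `zᵢᵀ / √m`. -/
def sampleMatrix {m N : ℕ} (z : Fin m → EuclideanSpace ℝ (Fin N)) : Matrix (Fin m) (Fin N) ℝ :=
  Matrix.of fun i k => z i k / √(m : ℝ)

/-- The vector of finite differences
`yᵢ = (E_f(x + δ U⁽ʲ⁾ zᵢ) - E_f(x)) / (√m δ)`, where the two oracle calls made for the index `i`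
return the exact values of `f` plus the noises `ξ i` and `ξ' i`. -/
def measurements {d J N m : ℕ} (e : Fin J × Fin N ≃ Fin d) (f : EuclideanSpace ℝ (Fin d) → ℝ)
    (j : Fin J) (x : EuclideanSpace ℝ (Fin d)) (δ : ℝ) (z : Fin m → EuclideanSpace ℝ (Fin N))
    (ξ ξ' : Fin m → ℝ) : EuclideanSpace ℝ (Fin m) :=
  WithLp.toLp 2 fun i =>
    ((f (x + δ • embed e j (z i)) + ξ i) - (f x + ξ' i)) / (√(m : ℝ) * δ)

/-- `g` is an output of the block gradient estimator at the point `x` and block `j`, with sparsity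
level `s`, query radius `δ`, `n` CoSaMP iterations, sample directions `z` and oracle noises
`ξ`, `ξ'`. -/
def IsBlockGradientEstimate {d J N m : ℕ} (e : Fin J × Fin N ≃ Fin d)
    (f : EuclideanSpace ℝ (Fin d) → ℝ) (j : Fin J) (x : EuclideanSpace ℝ (Fin d)) (s : ℕ) (δ : ℝ)
    (n : ℕ) (z : Fin m → EuclideanSpace ℝ (Fin N)) (ξ ξ' : Fin m → ℝ)
    (g : EuclideanSpace ℝ (Fin N)) : Prop :=
  IsCoSaMPOutput (sampleMatrix z) (measurements e f j x δ z ξ ξ') s n g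

/-- `z₁, …, z_m` are independent Rademacher vectors: all their entries are independent random
variables with values `1` and `-1`, each with probability `1/2`. -/
structure IsRademacherFamily {Ω : Type*} [MeasurableSpace Ω] (μ : Measure Ω) {m N : ℕ}
    (z : Ω → Fin m → EuclideanSpace ℝ (Fin N)) : Prop where
  measurable : ∀ i k, Measurable fun ω => z ω i k
  indep : iIndepFun (fun (p : Fin m × Fin N) (ω : Ω) => z ω p.1 p.2) μ
  prob_one : ∀ i k, μ {ω | z ω i k = 1} = 1 / 2
  prob_neg_one : ∀ i k, μ {ω | z ω i k = -1} = 1 / 2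

/-! ### The estimator always has an output -/

theorem exists_isBestSparseApprox {N : ℕ} (k : ℕ) (v : EuclideanSpace ℝ (Fin N)) :
    ∃ w, IsBestSparseApprox k v w := by
  classical
  let r : Finset (Fin N) → EuclideanSpace ℝ (Fin N) := fun S =>
    WithLp.toLp 2 fun i => if i ∈ S then v i else 0
  have hr : ∀ S, supp (r S) ⊆ S := by
    intro S i hi
    by_contra h
    simp [supp, r, h] at hi
  obtain ⟨S, hS, hmin⟩ := Finset.exists_min_image
    (Finset.univ.filter fun S : Finset (Fin N) => S.card ≤ k) (fun S => ‖v - r S‖)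
    ⟨∅, by simp⟩
  refine ⟨r S, (Finset.card_le_card (hr S)).trans (by simpa using hS), fun u hu => ?_⟩
  refine (hmin (supp u) (by simpa [l0] using hu)).trans ?_
  rw [EuclideanSpace.norm_eq, EuclideanSpace.norm_eq]
  apply Real.sqrt_le_sqrt
  apply Finset.sum_le_sum
  intro i _
  by_cases h : u i = 0
  · simp [r, supp, h]
  · simp [r, supp, h, sq_nonneg]

theorem exists_isLeastSquaresOn {m N : ℕ} (Z : Matrix (Fin m) (Fin N) ℝ)
    (y : EuclideanSpace ℝ (Fin m)) (T : Finset (Fin N)) : ∃ b, IsLeastSquaresOn Z y T b := by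
  let V : Submodule ℝ (EuclideanSpace ℝ (Fin N)) :=
    { carrier := {c | ∀ i, i ∉ T → c i = 0}
      add_mem' := fun ha hb i hi => by simp [ha i hi, hb i hi]
      zero_mem' := fun i _ => rfl
      smul_mem' := fun r a ha i hi => by simp [ha i hi] }
  have hV : ∀ c, c ∈ V ↔ supp c ⊆ T := by
    intro c
    constructor
    · intro h i hi
      by_contra hT
      simp [supp, h i hT] at hi
    · intro h i hi
      by_contra hc
      exact hi (h (by simp [supp, hc]))
  let W := V.map Z.toEuclideanLin
  obtain ⟨b, hb, hbW⟩ := Submodule.mem_map.1 (W.starProjection_apply_mem y)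
  refine ⟨b, (hV b).1 hb, fun c hc => ?_⟩
  have h1 := W.starProjection_minimal y
  rw [hbW, norm_sub_rev, norm_sub_rev _ y, h1]
  exact ciInf_le ⟨0, by rintro _ ⟨w, rfl⟩; positivity⟩
    (⟨_, Submodule.mem_map_of_mem ((hV c).2 hc)⟩ : W)

theorem exists_isCoSaMPOutput {m N : ℕ} (Z : Matrix (Fin m) (Fin N) ℝ)
    (y : EuclideanSpace ℝ (Fin m)) (s n : ℕ) : ∃ g, IsCoSaMPOutput Z y s n g := by
  have h : ∀ a, ∃ a', CoSaMPStep Z y s a a' := by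
    intro a
    obtain ⟨p, hp⟩ := exists_isBestSparseApprox (2 * s)
      (Zᵀ.toEuclideanLin (y - Z.toEuclideanLin a))
    obtain ⟨b, hb⟩ := exists_isLeastSquaresOn Z y (supp p ∪ supp a)
    obtain ⟨a', ha'⟩ := exists_isBestSparseApprox s b
    exact ⟨a', p, b, hp, hb, ha'⟩
  choose F hF using h
  refine ⟨_, fun k => F^[k] 0, rfl, fun k _ => ?_, rfl⟩
  simp only [Function.iterate_succ_apply']
  exact hF _

end BlockGrad

end

/-!
The estimator runs CoSaMP on the linear system `Z c = y`, whose matrix `Z` is a normalised Rademacher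
matrix and whose right-hand side is `Z g` plus an error, `g` being the sparse block gradient.

The error is small for every choice of signs. By Taylor's formula, a finite difference of step `δ`
along `U⁽ʲ⁾ zᵢ` misses `⟪g, zᵢ⟫` by at most `δ H / 2`, because the quadratic form of the block
Hessian at a sign vector is at most the sum of the absolute values of its entries; the oracle
noise adds `2 σ / δ`. The choice `δ = 2 √(σ / H)` balances the two, and the error has norm at most
`2 √(σ H)` (`norm_measurements_sub_le`).

CoSaMP converges geometrically, to within a multiple of the error, as soon as `Z` has the restricted
isometry property of order `4 s` (`IsCoSaMPOutput.norm_sub_le`). This is the classical argument: the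
proxy `Zᵀ (y - Z a)` is close to the residual `g - a` on sets of `4 s` coordinates, so its `2 s`
largest entries carry nearly all of the residual; least squares then recovers `g` up to the part of
it off the merged support; pruning at most doubles the error.

The restricted isometry property holds with high probability (`exists_restrictedIsometry`). For a
fixed unit vector `v`, the variables `⟪zᵢ, v⟫²` have mean one and moment generating function at most
`exp (θ + 8 θ²)` for `|θ| ≤ 1 / 8` (`sum_exp_rademacher_sq_le_of_unit`), so Chernoff's bound shows
that `‖Z v‖²` concentrates around one, with failure probability exponentially small in `m`. A union
bound over nets of the coordinate subspaces of dimension `4 s` costs a factor `4 (25 N) ^ (4 s)`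
(`exists_test_vectors`). Since `N = d / J ≥ 2`, this is at most `N ^ (26 s)`, and a number
`m ≥ b₁ s log N` of samples with `b₁` large absorbs it (`failure_bound`).
-/

noncomputable section

namespace BlockGrad

/-! ### Restriction of vectors to coordinate sets -/

section Restrict

variable {N : ℕ}

/-- The vector that agrees with `v` on `S` and vanishes off `S`. -/
def restrict (S : Finset (Fin N)) (v : EuclideanSpace ℝ (Fin N)) : EuclideanSpace ℝ (Fin N) :=
  WithLp.toLp 2 fun i => if i ∈ S then v i else 0

@[simp] lemma restrict_apply (S : Finset (Fin N)) (v : EuclideanSpace ℝ (Fin N)) (i : Fin N) :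
    restrict S v i = if i ∈ S then v i else 0 := rfl

lemma supp_subset_iff {v : EuclideanSpace ℝ (Fin N)} {T : Finset (Fin N)} :
    supp v ⊆ T ↔ ∀ i, i ∉ T → v i = 0 := by
  simp only [supp, Finset.subset_iff, Finset.mem_filter, Finset.mem_univ, true_and]
  exact forall_congr' fun i => not_imp_comm

lemma supp_restrict_subset (S : Finset (Fin N)) (v : EuclideanSpace ℝ (Fin N)) :
    supp (restrict S v) ⊆ S :=
  supp_subset_iff.2 fun i hi => by simp [hi]

lemma supp_sub_subset (u v : EuclideanSpace ℝ (Fin N)) : supp (u - v) ⊆ supp u ∪ supp v := by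
  rw [supp_subset_iff]
  intro i hi
  simp only [supp, Finset.mem_union, Finset.mem_filter, Finset.mem_univ, true_and, not_or,
    not_not] at hi
  simp [hi.1, hi.2]

lemma inner_restrict_right (S : Finset (Fin N)) (u v : EuclideanSpace ℝ (Fin N)) :
    inner ℝ u (restrict S v) = ∑ i ∈ S, u i * v i := by
  simp [PiLp.inner_apply, Finset.sum_ite_mem, mul_comm]

lemma norm_restrict_sq (S : Finset (Fin N)) (v : EuclideanSpace ℝ (Fin N)) :
    ‖restrict S v‖ ^ 2 = ∑ i ∈ S, v i ^ 2 := by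
  simp [EuclideanSpace.norm_sq_eq, ite_pow]

lemma inner_self_restrict (S : Finset (Fin N)) (v : EuclideanSpace ℝ (Fin N)) :
    inner ℝ v (restrict S v) = ‖restrict S v‖ ^ 2 := by
  rw [inner_restrict_right, norm_restrict_sq]
  exact Finset.sum_congr rfl fun i _ => (sq _).symm

lemma norm_restrict_le_norm_restrict {S T : Finset (Fin N)} (h : S ⊆ T)
    (v : EuclideanSpace ℝ (Fin N)) : ‖restrict S v‖ ≤ ‖restrict T v‖ := by
  refine (sq_le_sq₀ (norm_nonneg _) (norm_nonneg _)).1 ?_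
  rw [norm_restrict_sq, norm_restrict_sq]
  exact Finset.sum_le_sum_of_subset_of_nonneg h fun _ _ _ => sq_nonneg _

lemma sub_restrict (S : Finset (Fin N)) (v : EuclideanSpace ℝ (Fin N)) :
    v - restrict S v = restrict Sᶜ v := by
  ext i
  by_cases hi : i ∈ S <;> simp [hi]

lemma norm_restrict_compl_supp_le (v p : EuclideanSpace ℝ (Fin N)) :
    ‖restrict (supp p)ᶜ v‖ ≤ ‖v - p‖ := by
  refine (sq_le_sq₀ (norm_nonneg _) (norm_nonneg _)).1 ?_
  rw [norm_restrict_sq, EuclideanSpace.norm_sq_eq]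
  calc ∑ i ∈ (supp p)ᶜ, v i ^ 2 = ∑ i ∈ (supp p)ᶜ, ‖(v - p) i‖ ^ 2 := by
        refine Finset.sum_congr rfl fun i hi => ?_
        have : p i = 0 := by simpa [supp] using hi
        simp [this]
    _ ≤ _ := Finset.sum_le_sum_of_subset_of_nonneg (Finset.subset_univ _) fun _ _ _ => sq_nonneg _

/-- A best `k`-sparse approximation captures at least as much of `v` as any `R` of size `k`; the
common part of the two supports cancels. -/
lemma IsBestSparseApprox.norm_restrict_sdiff_le {k : ℕ} {v p : EuclideanSpace ℝ (Fin N)}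
    (h : IsBestSparseApprox k v p) {R : Finset (Fin N)} (hR : R.card ≤ k) :
    ‖restrict (R \ supp p) v‖ ≤ ‖restrict (supp p \ R) v‖ := by
  have h1 : ‖restrict (supp p)ᶜ v‖ ≤ ‖restrict Rᶜ v‖ := by
    rw [← sub_restrict R v]
    exact (norm_restrict_compl_supp_le v p).trans
      (h.2 _ ((Finset.card_le_card (supp_restrict_subset R v)).trans hR))
  refine (sq_le_sq₀ (norm_nonneg _) (norm_nonneg _)).1 ?_
  have h2 := pow_le_pow_left₀ (norm_nonneg _) h1 2
  simp only [norm_restrict_sq] at h2 ⊢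
  have key : ∀ A B : Finset (Fin N),
      ∑ i ∈ Aᶜ, v i ^ 2 = ∑ i ∈ B \ A, v i ^ 2 + ∑ i ∈ (A ∪ B)ᶜ, v i ^ 2 := by
    intro A B
    rw [← Finset.sum_union]
    · congr 1
      ext i
      simp only [Finset.mem_compl, Finset.mem_union, Finset.mem_sdiff]
      tauto
    · rw [Finset.disjoint_left]
      intro i
      simp only [Finset.mem_compl, Finset.mem_union, Finset.mem_sdiff]
      tauto
  rw [key _ R, key R (supp p), Finset.union_comm R] at h2
  linarith

end Restrict

/-! ### Convergence of CoSaMP under the restricted isometry property -/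

section CoSaMP

variable {m N : ℕ}

/-- The restricted isometry property of order `K` with constant `η`, in bilinear form: on each
space of vectors supported in a fixed set of at most `K` coordinates, the Gram form of `Z` differs
from the standard inner product by a form of norm at most `η`. -/
def RestrictedIsometry (Z : Matrix (Fin m) (Fin N) ℝ) (K : ℕ) (η : ℝ) : Prop :=
  ∀ T : Finset (Fin N), T.card ≤ K → ∀ u v : EuclideanSpace ℝ (Fin N), supp u ⊆ T → supp v ⊆ T →
    |inner ℝ (Z.toEuclideanLin u) (Z.toEuclideanLin v) - inner ℝ u v| ≤ η * ‖u‖ * ‖v‖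

lemma inner_transpose_toEuclideanLin (Z : Matrix (Fin m) (Fin N) ℝ) (y : EuclideanSpace ℝ (Fin m))
    (w : EuclideanSpace ℝ (Fin N)) :
    inner ℝ (Zᵀ.toEuclideanLin y) w = inner ℝ y (Z.toEuclideanLin w) := by
  rw [← Matrix.conjTranspose_eq_transpose_of_trivial,
    Matrix.toEuclideanLin_conjTranspose_eq_adjoint, LinearMap.adjoint_inner_left]

lemma RestrictedIsometry.norm_le {Z : Matrix (Fin m) (Fin N) ℝ} {K : ℕ}
    (hZ : RestrictedIsometry Z K (1 / 10)) {T : Finset (Fin N)} (hT : T.card ≤ K)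
    {w : EuclideanSpace ℝ (Fin N)} (hw : supp w ⊆ T) :
    ‖Z.toEuclideanLin w‖ ≤ 21 / 20 * ‖w‖ := by
  have h := (abs_le.1 (hZ T hT w w hw hw)).2
  rw [real_inner_self_eq_norm_sq, real_inner_self_eq_norm_sq] at h
  refine (sq_le_sq₀ (norm_nonneg _) (by positivity)).1 ?_
  nlinarith [sq_nonneg ‖w‖]

/-- The normal equations for least squares on the coordinates in `T`. -/
lemma IsLeastSquaresOn.inner_eq_zero {Z : Matrix (Fin m) (Fin N) ℝ} {y : EuclideanSpace ℝ (Fin m)}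
    {T : Finset (Fin N)} {b w : EuclideanSpace ℝ (Fin N)} (hb : IsLeastSquaresOn Z y T b)
    (hw : supp w ⊆ T) : inner ℝ (Z.toEuclideanLin b - y) (Z.toEuclideanLin w) = 0 := by
  set A := Z.toEuclideanLin b - y with hA
  set W := Z.toEuclideanLin w with hW
  have key : ∀ r : ℝ, 0 ≤ r * (2 * inner ℝ A W) + r ^ 2 * ‖W‖ ^ 2 := by
    intro r
    have h := hb.2 (b + r • w) (supp_subset_iff.2 fun i hi => by
      simp [supp_subset_iff.1 hb.1 i hi, supp_subset_iff.1 hw i hi])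
    have e : Z.toEuclideanLin (b + r • w) - y = A + r • W := by
      rw [map_add, map_smul, hA, hW]; abel
    rw [e] at h
    have h2 := pow_le_pow_left₀ (norm_nonneg _) h 2
    rw [norm_add_sq_real, norm_smul, inner_smul_right, mul_pow, Real.norm_eq_abs, sq_abs] at h2
    linarith
  by_contra hne
  -- the minimum over `r` of the quadratic in `key` is negative unless its linear part vanishes
  have h1 := key (-(inner ℝ A W) / (‖W‖ ^ 2 + 1))
  have hpos : 0 < ‖W‖ ^ 2 + 1 := by positivity
  have h2 : -(inner ℝ A W) / (‖W‖ ^ 2 + 1) * (2 * inner ℝ A W) +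
      (-(inner ℝ A W) / (‖W‖ ^ 2 + 1)) ^ 2 * ‖W‖ ^ 2 =
      -(inner ℝ A W) ^ 2 * (‖W‖ ^ 2 + 2) / (‖W‖ ^ 2 + 1) ^ 2 := by
    field_simp
    ring
  rw [h2] at h1
  have h3 : 0 < (inner ℝ A W) ^ 2 * (‖W‖ ^ 2 + 2) / (‖W‖ ^ 2 + 1) ^ 2 := by positivity
  rw [neg_mul, neg_div] at h1
  linarith

/-- Every large part of the residual `r` is picked up by the `2s` largest entries of the proxy
`Zᵀ (Z r + ν)`. -/
lemma norm_restrict_compl_le_of_proxy {Z : Matrix (Fin m) (Fin N) ℝ} {s : ℕ}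
    (hZ : RestrictedIsometry Z (4 * s) (1 / 10)) {r p : EuclideanSpace ℝ (Fin N)}
    {ν : EuclideanSpace ℝ (Fin m)} (hr : (supp r).card ≤ 2 * s)
    (hp : IsBestSparseApprox (2 * s) (Zᵀ.toEuclideanLin (Z.toEuclideanLin r + ν)) p) :
    ‖restrict (supp p)ᶜ r‖ ≤ 1 / 5 * ‖r‖ + 21 / 10 * ‖ν‖ := by
  set u := Zᵀ.toEuclideanLin (Z.toEuclideanLin r + ν) with hu
  set T := supp r ∪ supp p with hTdef
  have hT : T.card ≤ 4 * s := by
    have : T.card ≤ _ := Finset.card_union_le (supp r) (supp p)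
    have := hp.1
    unfold l0 at this
    omega
  have hrT : supp r ⊆ T := Finset.subset_union_left
  -- on `T` the proxy agrees with `r` up to a small error
  have hprox : ∀ w, supp w ⊆ T →
      |inner ℝ u w - inner ℝ r w| ≤ (1 / 10 * ‖r‖ + 21 / 20 * ‖ν‖) * ‖w‖ := by
    intro w hw
    rw [hu, inner_transpose_toEuclideanLin, inner_add_left, add_sub_right_comm]
    refine (abs_add_le _ _).trans ?_
    have h1 := hZ T hT r w hrT hw
    have h2 := abs_real_inner_le_norm ν (Z.toEuclideanLin w)
    have h3 := mul_le_mul_of_nonneg_left (hZ.norm_le hT hw) (norm_nonneg ν)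
    linarith
  have hid := hp.norm_restrict_sdiff_le hr
  have h1 : ‖restrict (supp p \ supp r) u‖ ≤ 1 / 10 * ‖r‖ + 21 / 20 * ‖ν‖ := by
    have hw : supp (restrict (supp p \ supp r) u) ⊆ T :=
      (supp_restrict_subset _ _).trans (Finset.sdiff_subset.trans Finset.subset_union_right)
    have h := hprox _ hw
    have h0 : inner ℝ r (restrict (supp p \ supp r) u) = 0 := by
      rw [inner_restrict_right]
      refine Finset.sum_eq_zero fun i hi => ?_
      rw [supp_subset_iff.1 subset_rfl i (Finset.mem_sdiff.1 hi).2, zero_mul]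
    rw [h0, sub_zero, inner_self_restrict, abs_of_nonneg (by positivity), sq] at h
    rcases (norm_nonneg (restrict (supp p \ supp r) u)).eq_or_lt with h' | h'
    · rw [← h']; positivity
    · exact le_of_mul_le_mul_right h h'
  have h2 : ‖restrict (supp r \ supp p) r‖ ≤
      ‖restrict (supp r \ supp p) u‖ + (1 / 10 * ‖r‖ + 21 / 20 * ‖ν‖) := by
    set w := restrict (supp r \ supp p) r with hw'
    have hw : supp w ⊆ T :=
      (supp_restrict_subset _ _).trans (Finset.sdiff_subset.trans Finset.subset_union_left)
    have h := (abs_le.1 (hprox w hw)).1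
    have h0 : inner ℝ u w = inner ℝ (restrict (supp r \ supp p) u) w := by
      rw [hw', inner_restrict_right, inner_restrict_right]
      exact Finset.sum_congr rfl fun i hi => by rw [restrict_apply, if_pos hi]
    have h3 := real_inner_le_norm (restrict (supp r \ supp p) u) w
    rw [h0, hw', inner_self_restrict, ← hw'] at h
    rcases (norm_nonneg w).eq_or_lt with h' | h'
    · rw [← h']; positivity
    · refine le_of_mul_le_mul_right ?_ h'
      nlinarith
  have h3 : restrict (supp p)ᶜ r = restrict (supp r \ supp p) r := by
    ext i
    by_cases hi : r i = 0
    · simp [hi]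
    · simp [supp, hi]
  rw [h3]
  linarith

/-- One CoSaMP step halves the error, up to a multiple of the measurement noise. -/
lemma CoSaMPStep.norm_sub_le {Z : Matrix (Fin m) (Fin N) ℝ} {s : ℕ}
    (hZ : RestrictedIsometry Z (4 * s) (1 / 10)) {y : EuclideanSpace ℝ (Fin m)}
    {g a a' : EuclideanSpace ℝ (Fin N)} (hg : l0 g ≤ s) (ha : l0 a ≤ s)
    (h : CoSaMPStep Z y s a a') :
    ‖a' - g‖ ≤ 1 / 2 * ‖a - g‖ + 7 * ‖y - Z.toEuclideanLin g‖ := by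
  obtain ⟨p, b, hp, hb, ha'⟩ := h
  unfold l0 at hg ha
  set ν := y - Z.toEuclideanLin g with hν
  have hcard : (supp (g - a)).card ≤ 2 * s := by
    have := Finset.card_le_card (supp_sub_subset g a)
    have := Finset.card_union_le (supp g) (supp a)
    omega
  have hp1 := hp.1
  unfold l0 at hp1
  have e : y - Z.toEuclideanLin a = Z.toEuclideanLin (g - a) + ν := by
    rw [hν, map_sub]; abel
  rw [e] at hp
  have hid := norm_restrict_compl_le_of_proxy hZ hcard hp
  set S := supp p ∪ supp a with hS
  set T := S ∪ supp g with hTdef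
  have hT : T.card ≤ 4 * s := by
    have : T.card ≤ _ := Finset.card_union_le S (supp g)
    have : S.card ≤ _ := Finset.card_union_le (supp p) (supp a)
    omega
  have hmiss : ‖restrict Sᶜ g‖ ≤ ‖restrict (supp p)ᶜ (g - a)‖ := by
    have : restrict Sᶜ g = restrict Sᶜ (g - a) := by
      ext i
      by_cases hi : i ∈ S
      · simp [hi]
      · simp [hi, supp_subset_iff.1 (Finset.subset_union_right : supp a ⊆ S) i hi]
    rw [this]
    exact norm_restrict_le_norm_restrict
      (Finset.compl_subset_compl.2 Finset.subset_union_left) _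
  -- error of the least squares estimate, split into its parts on and off `S`
  set w := restrict S (b - g) with hw
  have hwS : supp w ⊆ S := supp_restrict_subset _ _
  have hsplit : b - g = w - restrict Sᶜ g := by
    ext i
    by_cases hi : i ∈ S
    · simp [hw, hi]
    · simp [hw, hi, supp_subset_iff.1 hb.1 i hi]
  have h1 : ‖b - g‖ ≤ ‖w‖ + ‖restrict Sᶜ g‖ := hsplit ▸ _root_.norm_sub_le _ _
  have h2 : ‖w‖ ≤ 1 / 10 * ‖b - g‖ + 21 / 20 * ‖ν‖ := by
    have hST : S ⊆ T := Finset.subset_union_left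
    have hbg : supp (b - g) ⊆ T :=
      (supp_sub_subset b g).trans (Finset.union_subset_union hb.1 subset_rfl)
    have hrip := (abs_le.1 (hZ T hT (b - g) w hbg (hwS.trans hST))).1
    have hne := hb.inner_eq_zero hwS
    have e2 : Z.toEuclideanLin b - y = Z.toEuclideanLin (b - g) - ν := by
      rw [hν, map_sub]; abel
    rw [e2, inner_sub_left] at hne
    have h3 := real_inner_le_norm ν (Z.toEuclideanLin w)
    have h4 := mul_le_mul_of_nonneg_left (hZ.norm_le hT (hwS.trans hST)) (norm_nonneg ν)
    rw [inner_self_restrict, ← hw] at hrip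
    rcases (norm_nonneg w).eq_or_lt with h' | h'
    · rw [← h']; positivity
    · refine le_of_mul_le_mul_right ?_ h'
      nlinarith
  have h3 : ‖a' - g‖ ≤ 2 * ‖b - g‖ := by
    have h4 := ha'.2 g hg
    have h5 := _root_.norm_sub_le (b - g) (b - a')
    rw [sub_sub_sub_cancel_left] at h5
    linarith
  rw [norm_sub_rev a g]
  have := norm_nonneg ν
  have := norm_nonneg (g - a)
  linarith

lemma IsCoSaMPOutput.norm_sub_le {Z : Matrix (Fin m) (Fin N) ℝ} {s n : ℕ}
    (hZ : RestrictedIsometry Z (4 * s) (1 / 10)) {y : EuclideanSpace ℝ (Fin m)}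
    {g g' : EuclideanSpace ℝ (Fin N)} (hg : l0 g ≤ s) (h : IsCoSaMPOutput Z y s n g') :
    ‖g' - g‖ ≤ (1 / 2) ^ n * ‖g‖ + 14 * ‖y - Z.toEuclideanLin g‖ := by
  obtain ⟨a, h0, hstep, rfl⟩ := h
  have key : ∀ k ≤ n, l0 (a k) ≤ s ∧
      ‖a k - g‖ ≤ (1 / 2) ^ k * ‖g‖ + 14 * ‖y - Z.toEuclideanLin g‖ := by
    intro k hk
    induction k with
    | zero =>
      refine ⟨by simp [h0, l0, supp], ?_⟩
      rw [h0, zero_sub, norm_neg, pow_zero, one_mul]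
      exact le_add_of_nonneg_right (by positivity)
    | succ k ih =>
      obtain ⟨hs, hle⟩ := ih (by omega)
      have hk' := hstep k (by omega)
      have h1 := hk'.norm_sub_le hZ hg hs
      obtain ⟨p, b, -, -, ha'⟩ := hk'
      refine ⟨ha'.1, h1.trans ?_⟩
      rw [pow_succ]
      linarith
  exact (key n le_rfl).2

end CoSaMP

/-! ### Finite differences along sign vectors -/

section Taylor

variable {d J N : ℕ} (e : Fin J × Fin N ≃ Fin d) (j : Fin J)

lemma embed_eq_sum (t : EuclideanSpace ℝ (Fin N)) :
    embed e j t = ∑ k, t k • EuclideanSpace.single (e (j, k)) (1 : ℝ) := by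
  ext i
  simp [embed, blockMatrix, Matrix.toLpLin_apply, Matrix.mulVec, dotProduct, Pi.single_apply]

lemma inner_gradient_embed (f : EuclideanSpace ℝ (Fin d) → ℝ) (x : EuclideanSpace ℝ (Fin d))
    (t : EuclideanSpace ℝ (Fin N)) :
    inner ℝ (∇ f x) (embed e j t) = ∑ k, t k * blockGradient e f j x k := by
  rw [embed_eq_sum, inner_sum]
  refine Finset.sum_congr rfl fun k _ => ?_
  rw [inner_smul_right, EuclideanSpace.inner_single_right]
  simp [blockGradient]

/-- Along the image of a sign vector, the second derivative of `f` is bounded by the entrywise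
`ℓ¹` norm of the block Hessian. -/
lemma abs_inner_fderiv_gradient_embed_le (f : EuclideanSpace ℝ (Fin d) → ℝ)
    (x : EuclideanSpace ℝ (Fin d)) {ε : EuclideanSpace ℝ (Fin N)}
    (hε : ∀ k, ε k = 1 ∨ ε k = -1) :
    |inner ℝ (fderiv ℝ (fun u => ∇ f u) x (embed e j ε)) (embed e j ε)| ≤
      ∑ k, ∑ l, |blockHessian e f j x k l| := by
  have habs : ∀ k, |ε k| = 1 := fun k => by rcases hε k with h | h <;> simp [h]
  have h : inner ℝ (fderiv ℝ (fun u => ∇ f u) x (embed e j ε)) (embed e j ε) =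
      ∑ k, ∑ l, ε k * ε l * blockHessian e f j x k l := by
    conv_lhs => rw [embed_eq_sum, inner_sum]
    refine Finset.sum_congr rfl fun k _ => ?_
    rw [inner_smul_right, EuclideanSpace.inner_single_right, map_sum, one_mul]
    simp only [map_smul, WithLp.ofLp_sum, Finset.sum_apply, WithLp.ofLp_smul, Pi.smul_apply,
      smul_eq_mul, map_sum, map_mul, conj_trivial, Finset.mul_sum]
    refine Finset.sum_congr rfl fun l _ => ?_
    simp only [blockHessian, Matrix.of_apply]
    ring
  rw [h]
  refine (Finset.abs_sum_le_sum_abs _ _).trans (Finset.sum_le_sum fun k _ => ?_)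
  refine (Finset.abs_sum_le_sum_abs _ _).trans (Finset.sum_le_sum fun l _ => ?_)
  rw [abs_mul, abs_mul, habs, habs, one_mul, one_mul]

/-- Second order Taylor bound for a function that is twice differentiable, without continuity of the
second derivative. -/
lemma abs_sub_sub_mul_le_of_abs_deriv_deriv_le {φ ψ χ : ℝ → ℝ} {δ H : ℝ} (hδ : 0 ≤ δ)
    (hφ : ∀ t, HasDerivAt φ (ψ t) t) (hψ : ∀ t, HasDerivAt ψ (χ t) t)
    (hχ : ∀ t ∈ Set.Icc 0 δ, |χ t| ≤ H) : |φ δ - φ 0 - δ * ψ 0| ≤ H * δ ^ 2 / 2 := by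
  have h1 : ∀ t ∈ Set.Icc 0 δ, |ψ t - ψ 0| ≤ H * t := by
    intro t ht
    have := (convex_Icc (0 : ℝ) δ).norm_image_sub_le_of_norm_hasDerivWithin_le
      (fun s _ => (hψ s).hasDerivWithinAt) hχ (Set.left_mem_Icc.2 hδ) ht
    simpa [abs_of_nonneg ht.1] using this
  have hG : ∀ t, HasDerivAt (fun t => φ t - φ 0 - t * ψ 0) (ψ t - ψ 0) t := fun t => by
    have := ((hφ t).sub_const (φ 0)).sub ((hasDerivAt_id t).mul_const (ψ 0))
    rw [one_mul] at this
    exact this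
  have hB : ∀ t : ℝ, HasDerivAt (fun t => H * t ^ 2 / 2) (H * t) t := fun t => by
    have h : H * ((2 : ℕ) * t ^ (2 - 1)) / 2 = H * t := by norm_num; ring
    exact h ▸ ((hasDerivAt_pow 2 t).const_mul H).div_const 2
  have := image_norm_le_of_norm_deriv_right_le_deriv_boundary
    (f := fun t => φ t - φ 0 - t * ψ 0) (f' := fun t => ψ t - ψ 0) (a := 0) (b := δ)
    (B := fun t => H * t ^ 2 / 2) (B' := fun t => H * t)
    (fun t _ => (hG t).continuousAt.continuousWithinAt)
    (fun t _ => (hG t).hasDerivWithinAt) (by simp) hB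
    (fun t ht => h1 t (Set.Ico_subset_Icc_self ht)) (Set.right_mem_Icc.2 hδ)
  simpa using this

variable {e j}

lemma WeaklySparseBlockHessian.abs_sub_sub_le {X : Set (EuclideanSpace ℝ (Fin d))}
    {f : EuclideanSpace ℝ (Fin d) → ℝ} {H δ : ℝ} (hf : WeaklySparseBlockHessian e X f H)
    (hδ : 0 ≤ δ) {x : EuclideanSpace ℝ (Fin d)} {ε : EuclideanSpace ℝ (Fin N)}
    (hε : ∀ k, ε k = 1 ∨ ε k = -1) (hX : segment ℝ x (x + δ • embed e j ε) ⊆ X) :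
    |f (x + δ • embed e j ε) - f x - δ * ∑ k, ε k * blockGradient e f j x k| ≤
      H * δ ^ 2 / 2 := by
  obtain ⟨hf1, hf2, hH⟩ := hf
  set v := embed e j ε with hv
  have hline : ∀ t : ℝ, HasDerivAt (fun t : ℝ => x + t • v) v t := fun t => by
    simpa using ((hasDerivAt_id t).smul_const v).const_add x
  have hφ : ∀ t : ℝ, HasDerivAt (fun t : ℝ => f (x + t • v)) (inner ℝ (∇ f (x + t • v)) v) t := by
    intro t
    have h1 := (hf1 (x + t • v)).hasGradientAt.hasFDerivAt.comp_hasDerivAt t (hline t)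
    rw [InnerProductSpace.toDual_apply_apply] at h1
    exact h1
  have hψ : ∀ t : ℝ, HasDerivAt (fun t : ℝ => inner ℝ (∇ f (x + t • v)) v)
      (inner ℝ (fderiv ℝ (fun u => ∇ f u) (x + t • v) v) v) t := by
    intro t
    have h1 := (hf2 (x + t • v)).hasFDerivAt.comp_hasDerivAt t (hline t)
    have h2 := h1.inner ℝ (hasDerivAt_const t v)
    rw [inner_zero_right, zero_add] at h2
    exact h2
  have := abs_sub_sub_mul_le_of_abs_deriv_deriv_le hδ hφ hψ (H := H) (fun t ht => by
    refine (abs_inner_fderiv_gradient_embed_le e j f (x + t • v) hε).trans (hH j _ (hX ?_))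
    rw [segment_eq_image']
    rcases hδ.eq_or_lt with h0 | h0
    · exact ⟨0, by simp, by
        have : t = 0 := le_antisymm (h0 ▸ ht.2) ht.1
        simp [this]⟩
    · refine ⟨t / δ, ⟨by have := ht.1; positivity, (div_le_one h0).2 ht.2⟩, ?_⟩
      simp only [add_sub_cancel_left, smul_smul]
      rw [div_mul_cancel₀ _ h0.ne'])
  simp only [zero_smul, add_zero] at this
  rwa [hv, inner_gradient_embed] at this

end Taylor

/-! ### Nets and test vectors for the restricted isometry property -/

section Nets

/-- A net for the ball of radius `2` in a space of dimension `n`, with at most `5 ^ n` points: a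
maximal separated set. -/
lemma exists_net (E : Type*) [NormedAddCommGroup E] [NormedSpace ℝ E] [FiniteDimensional ℝ E] :
    ∃ Q : Finset E, Q.card ≤ 5 ^ Module.finrank ℝ E ∧ (∀ q ∈ Q, ‖q‖ ≤ 2) ∧
      ∀ v : E, ‖v‖ ≤ 2 → ∃ q ∈ Q, ‖v - q‖ ≤ 1 := by
  classical
  by_contra! hcon
  -- if no separated set were a net, then points could be added forever
  have key : ∀ n : ℕ, ∃ Q : Finset E, Q.card = n ∧ (∀ q ∈ Q, ‖q‖ ≤ 2) ∧
      ∀ p ∈ Q, ∀ q ∈ Q, p ≠ q → 1 ≤ ‖p - q‖ := by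
    intro n
    induction n with
    | zero => exact ⟨∅, by simp⟩
    | succ n ih =>
      obtain ⟨Q, hc, h2, hs⟩ := ih
      obtain ⟨v, hv, hvQ⟩ := hcon Q (Besicovitch.card_le_of_separated Q h2 hs) h2
      have hnot : v ∉ Q := fun h => by simpa using (hvQ v h).trans_le' zero_le_one
      refine ⟨insert v Q, by rw [Finset.card_insert_of_notMem hnot, hc], ?_, ?_⟩
      · simp only [Finset.mem_insert, forall_eq_or_imp]
        exact ⟨hv, h2⟩
      · intro p hp q hq hpq
        rcases Finset.mem_insert.1 hp with rfl | hp' <;> rcases Finset.mem_insert.1 hq with rfl | hq'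
        · exact absurd rfl hpq
        · exact (hvQ q hq').le
        · rw [norm_sub_rev]; exact (hvQ p hp').le
        · exact hs p hp' q hq' hpq
  obtain ⟨Q, hc, h2, hs⟩ := key (5 ^ Module.finrank ℝ E + 1)
  have := Besicovitch.card_le_of_separated Q h2 hs
  omega

lemma opNorm_le_of_net {E F : Type*} [NormedAddCommGroup E] [NormedSpace ℝ E]
    [SeminormedAddCommGroup F] [NormedSpace ℝ F] {Q : Finset E}
    (hQ : ∀ v : E, ‖v‖ ≤ 2 → ∃ q ∈ Q, ‖v - q‖ ≤ 1) {C : ℝ} (hC : 0 ≤ C) (ℓ : E →L[ℝ] F)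
    (h : ∀ q ∈ Q, ‖ℓ q‖ ≤ C) : ‖ℓ‖ ≤ C := by
  have key : ‖ℓ‖ ≤ (C + ‖ℓ‖) / 2 := by
    refine ℓ.opNorm_le_of_unit_norm (by positivity) fun v hv => ?_
    obtain ⟨q, hq, hvq⟩ := hQ ((2 : ℝ) • v) (by rw [norm_smul, hv]; norm_num)
    have h1 : ‖ℓ ((2 : ℝ) • v)‖ ≤ ‖ℓ q‖ + ‖ℓ ((2 : ℝ) • v - q)‖ := by
      have := norm_add_le (ℓ q) (ℓ ((2 : ℝ) • v - q))
      rwa [← map_add, add_sub_cancel] at this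
    have h2 := ℓ.le_opNorm_of_le hvq
    rw [map_smul, norm_smul] at h1
    have h3 := h q hq
    norm_num at h1 h2
    linarith
  linarith

variable {N : ℕ}

lemma norm_toLp_dite (T : Finset (Fin N)) (v : EuclideanSpace ℝ T) :
    ‖(WithLp.toLp 2 fun i => if h : i ∈ T then v ⟨i, h⟩ else 0 : EuclideanSpace ℝ (Fin N))‖ =
      ‖v‖ := by
  refine (sq_eq_sq₀ (norm_nonneg _) (norm_nonneg _)).1 ?_
  rw [EuclideanSpace.norm_sq_eq, EuclideanSpace.norm_sq_eq,
    ← Finset.sum_subset (Finset.subset_univ T) fun i _ hi => by simp [hi], ← Finset.sum_coe_sort]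
  exact Finset.sum_congr rfl fun i _ => by simp

/-- Extension by zero, as an isometric embedding of the coordinate space of `T`. -/
def extendZero (T : Finset (Fin N)) : EuclideanSpace ℝ T →ₗᵢ[ℝ] EuclideanSpace ℝ (Fin N) where
  toFun v := WithLp.toLp 2 fun i => if h : i ∈ T then v ⟨i, h⟩ else 0
  map_add' u v := by
    ext i
    simp only [PiLp.add_apply]
    split_ifs <;> simp
  map_smul' r v := by
    ext i
    simp only [PiLp.smul_apply]
    split_ifs <;> simp
  norm_map' v := norm_toLp_dite T v

lemma exists_extendZero_eq {T : Finset (Fin N)} {v : EuclideanSpace ℝ (Fin N)} (h : supp v ⊆ T) :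
    ∃ u, extendZero T u = v := by
  refine ⟨WithLp.toLp 2 fun i => v i, ?_⟩
  ext i
  by_cases hi : i ∈ T
  · simp [extendZero, hi]
  · simp [extendZero, hi, supp_subset_iff.1 h i hi]

/-- The defect `⟪Z u, Z v⟫ - ⟪u, v⟫` on the coordinate space of `T`, as a bounded bilinear form. -/
def gramDefect {m : ℕ} (Z : Matrix (Fin m) (Fin N) ℝ) (T : Finset (Fin N)) :
    EuclideanSpace ℝ T →L[ℝ] EuclideanSpace ℝ T →L[ℝ] ℝ :=
  let A : EuclideanSpace ℝ T →L[ℝ] EuclideanSpace ℝ (Fin m) :=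
    LinearMap.toContinuousLinearMap (Z.toEuclideanLin ∘ₗ (extendZero T).toLinearMap)
  (innerSL ℝ).bilinearComp A A - innerSL ℝ

lemma gramDefect_apply {m : ℕ} (Z : Matrix (Fin m) (Fin N) ℝ) (T : Finset (Fin N))
    (u v : EuclideanSpace ℝ T) :
    gramDefect Z T u v = inner ℝ (Z.toEuclideanLin (extendZero T u))
      (Z.toEuclideanLin (extendZero T v)) - inner ℝ (extendZero T u) (extendZero T v) := by
  rw [LinearIsometry.inner_map_map]
  rfl

/-- If `Z` nearly preserves the norms of the sums and differences of net points, then it is nearly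
an isometry on the whole coordinate space; this is polarisation followed by two uses of the net. -/
lemma norm_gramDefect_le {m : ℕ} {Z : Matrix (Fin m) (Fin N) ℝ} {T : Finset (Fin N)} {t : ℝ}
    (ht : 0 ≤ t) {Q : Finset (EuclideanSpace ℝ T)} (hQ2 : ∀ q ∈ Q, ‖q‖ ≤ 2)
    (hQ : ∀ v : EuclideanSpace ℝ T, ‖v‖ ≤ 2 → ∃ q ∈ Q, ‖v - q‖ ≤ 1)
    (h : ∀ p ∈ Q, ∀ q ∈ Q, ∀ w ∈ ({extendZero T (p + q), extendZero T (p - q)} : Set _),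
      |‖Z.toEuclideanLin w‖ ^ 2 - ‖w‖ ^ 2| ≤ t * ‖w‖ ^ 2) :
    ‖gramDefect Z T‖ ≤ 4 * t := by
  refine opNorm_le_of_net hQ (by positivity) _ fun p hp => ?_
  refine opNorm_le_of_net hQ (by positivity) _ fun q hq => ?_
  have h1 := h p hp q hq _ (Or.inl rfl)
  have h2 := h p hp q hq _ (Or.inr rfl)
  have hpar := parallelogram_law_with_norm ℝ p q
  have hpol : 4 * gramDefect Z T p q =
      (‖Z.toEuclideanLin (extendZero T (p + q))‖ ^ 2 - ‖extendZero T (p + q)‖ ^ 2) -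
      (‖Z.toEuclideanLin (extendZero T (p - q))‖ ^ 2 - ‖extendZero T (p - q)‖ ^ 2) := by
    rw [gramDefect_apply]
    simp only [map_add, map_sub, norm_add_sq_real, norm_sub_sq_real]
    ring
  rw [LinearIsometry.norm_map] at h1 h2 hpol
  rw [LinearIsometry.norm_map] at hpol
  have hp2 : ‖p‖ * ‖p‖ ≤ 4 := by nlinarith [hQ2 p hp, norm_nonneg p]
  have hq2 : ‖q‖ * ‖q‖ ≤ 4 := by nlinarith [hQ2 q hq, norm_nonneg q]
  have hsum : t * ‖p + q‖ ^ 2 + t * ‖p - q‖ ^ 2 ≤ 16 * t := by nlinarith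
  rw [Real.norm_eq_abs, abs_le]
  rw [abs_le] at h1 h2
  constructor <;> linarith

/-- A finite family of test vectors certifying the restricted isometry property of order `K`. -/
lemma exists_test_vectors (hN : 0 < N) (K : ℕ) :
    ∃ W : Finset (EuclideanSpace ℝ (Fin N)), W.card ≤ 2 * (25 * N) ^ K ∧
      ∀ (m : ℕ) (Z : Matrix (Fin m) (Fin N) ℝ) (t : ℝ), 0 ≤ t →
        (∀ w ∈ W, |‖Z.toEuclideanLin w‖ ^ 2 - ‖w‖ ^ 2| ≤ t * ‖w‖ ^ 2) →
        RestrictedIsometry Z K (4 * t) := by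
  classical
  choose Q hcard hQ2 hQ using fun T : Finset (Fin N) => exists_net (EuclideanSpace ℝ T)
  let V : Finset (Fin N) → Finset (EuclideanSpace ℝ (Fin N)) := fun T =>
    (Q T ×ˢ Q T).image (fun x => extendZero T (x.1 + x.2)) ∪
      (Q T ×ˢ Q T).image (fun x => extendZero T (x.1 - x.2))
  set k := min K N with hk
  refine ⟨(Finset.powersetCard k Finset.univ).biUnion V, ?_, ?_⟩
  · have hV : ∀ T ∈ Finset.powersetCard k (Finset.univ : Finset (Fin N)),
        (V T).card ≤ 2 * 25 ^ k := by
      intro T hT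
      have hTk : T.card = k := (Finset.mem_powersetCard.1 hT).2
      have h1 : (Q T ×ˢ Q T).card ≤ 25 ^ k := by
        have h2 := hcard T
        rw [finrank_euclideanSpace, Fintype.card_coe, hTk] at h2
        rw [Finset.card_product]
        calc _ ≤ 5 ^ k * 5 ^ k := Nat.mul_le_mul h2 h2
          _ = 25 ^ k := by rw [← mul_pow]; norm_num
      refine (Finset.card_union_le _ _).trans ?_
      have := (Finset.card_image_le (s := Q T ×ˢ Q T)
        (f := fun x => extendZero T (x.1 + x.2))).trans h1
      have := (Finset.card_image_le (s := Q T ×ˢ Q T)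
        (f := fun x => extendZero T (x.1 - x.2))).trans h1
      omega
    refine (Finset.card_biUnion_le_card_mul _ _ _ hV).trans ?_
    rw [Finset.card_powersetCard, Finset.card_univ, Fintype.card_fin]
    calc N.choose k * (2 * 25 ^ k) ≤ N ^ k * (2 * 25 ^ k) :=
          Nat.mul_le_mul_right _ (Nat.choose_le_pow _ _)
      _ = 2 * (25 * N) ^ k := by rw [mul_pow]; ring
      _ ≤ 2 * (25 * N) ^ K :=
          Nat.mul_le_mul_left _ (Nat.pow_le_pow_right (by omega) (min_le_left _ _))
  · intro m Z t ht hW T hT u v hu hv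
    obtain ⟨T', hTT', -, hT'⟩ := Finset.exists_subsuperset_card_eq (Finset.subset_univ T)
      (n := k) (le_min hT (by simpa using Finset.card_le_univ T)) (by simp [hk])
    obtain ⟨u, rfl⟩ := exists_extendZero_eq (hu.trans hTT')
    obtain ⟨v, rfl⟩ := exists_extendZero_eq (hv.trans hTT')
    rw [← gramDefect_apply, LinearIsometry.norm_map, LinearIsometry.norm_map]
    refine ((gramDefect Z T').le_opNorm₂ u v).trans ?_
    gcongr
    refine norm_gramDefect_le ht (hQ2 T') (hQ T') fun p hp q hq w hw => hW w ?_
    rw [Finset.mem_biUnion]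
    refine ⟨T', by simp [Finset.mem_powersetCard, hT'], ?_⟩
    simp only [V, Finset.mem_union, Finset.mem_image, Finset.mem_product, Prod.exists]
    rcases hw with rfl | rfl
    · exact Or.inl ⟨p, q, ⟨hp, hq⟩, rfl⟩
    · exact Or.inr ⟨p, q, ⟨hp, hq⟩, rfl⟩

end Nets

/-! ### Concentration for Rademacher sums -/

section Concentration

/-- The sign `±1` encoded by a Boolean. -/
def sgn (b : Bool) : ℝ := if b then 1 else -1

lemma sum_exp_sq_le (θ a v : ℝ) :
    ∑ b : Bool, Real.exp (θ * (a + sgn b * v) ^ 2) ≤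
      2 * (Real.exp (θ * v ^ 2) * Real.exp ((θ + 2 * θ ^ 2 * v ^ 2) * a ^ 2)) := by
  have h := Real.cosh_le_exp_half_sq (2 * θ * a * v)
  calc ∑ b : Bool, Real.exp (θ * (a + sgn b * v) ^ 2)
      = 2 * (Real.exp (θ * v ^ 2) * (Real.exp (θ * a ^ 2) * Real.cosh (2 * θ * a * v))) := by
        rw [Fintype.sum_bool, Real.cosh_eq]
        simp only [sgn, if_true, Bool.false_eq_true, if_false]
        have e1 : θ * (a + 1 * v) ^ 2 = θ * v ^ 2 + (θ * a ^ 2 + 2 * θ * a * v) := by ring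
        have e2 : θ * (a + -1 * v) ^ 2 = θ * v ^ 2 + (θ * a ^ 2 + -(2 * θ * a * v)) := by ring
        rw [e1, e2, Real.exp_add, Real.exp_add, Real.exp_add (θ * v ^ 2), Real.exp_add (θ * a ^ 2)]
        ring
    _ ≤ 2 * (Real.exp (θ * v ^ 2) * (Real.exp (θ * a ^ 2) *
          Real.exp ((2 * θ * a * v) ^ 2 / 2))) := by gcongr
    _ = _ := by
        rw [← Real.exp_add (θ * a ^ 2)]
        congr 3
        ring

/-- A bound for the moment generating function of the square of a Rademacher sum, valid for
exponents of both signs. The signs are averaged out one at a time: by `cosh x ≤ exp (x² / 2)`, each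
one changes the exponent `θ` to `θ + 2 θ² vᵢ²` and contributes a factor `exp (θ vᵢ²)`. -/
lemma sum_exp_rademacher_sq_le (n : ℕ) (v : Fin n → ℝ) (θ a M : ℝ) (hθ : |θ| ≤ M)
    (hM : θ + 2 * M ^ 2 * ∑ i, v i ^ 2 ≤ M) :
    ∑ ε : Fin n → Bool, Real.exp (θ * (a + ∑ i, sgn (ε i) * v i) ^ 2) ≤
      2 ^ n * Real.exp ((θ + 2 * M ^ 2 * ∑ i, v i ^ 2) * (a ^ 2 + ∑ i, v i ^ 2)) := by
  induction n generalizing θ with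
  | zero => simp
  | succ n ih =>
    rw [Fin.sum_univ_succ] at hM
    rw [← (Fin.consEquiv fun _ => Bool).sum_comp, Fintype.sum_prod_type_right]
    simp only [Fin.consEquiv, Equiv.coe_fn_mk, Fin.sum_univ_succ, Fin.cons_zero, Fin.cons_succ]
    set V := ∑ i : Fin n, v i.succ ^ 2 with hV
    have hV0 : 0 ≤ V := Finset.sum_nonneg fun _ _ => sq_nonneg _
    have hM0 : 0 ≤ M := (abs_nonneg _).trans hθ
    set θ' := θ + 2 * θ ^ 2 * v 0 ^ 2 with hθ'
    have hsq : θ ^ 2 ≤ M ^ 2 := sq_le_sq' (abs_le.1 hθ).1 (abs_le.1 hθ).2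
    have hstep : θ' ≤ θ + 2 * M ^ 2 * v 0 ^ 2 := by
      have := mul_le_mul_of_nonneg_right hsq (sq_nonneg (v 0))
      linarith
    have hΛ : θ' + 2 * M ^ 2 * V ≤ θ + 2 * M ^ 2 * (v 0 ^ 2 + V) := by linarith
    have hMV : 0 ≤ 2 * M ^ 2 * V := by positivity
    have hMv : 0 ≤ 2 * M ^ 2 * v 0 ^ 2 := by positivity
    have hθ'M : |θ'| ≤ M := by
      refine abs_le.2 ⟨?_, by linarith⟩
      have : 0 ≤ 2 * θ ^ 2 * v 0 ^ 2 := by positivity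
      linarith [(abs_le.1 hθ).1]
    have hih := ih (fun i => v i.succ) θ' hθ'M (hΛ.trans hM)
    calc ∑ ε : Fin n → Bool, ∑ b : Bool,
          Real.exp (θ * (a + (sgn b * v 0 + ∑ i, sgn (ε i) * v i.succ)) ^ 2)
        ≤ ∑ ε : Fin n → Bool, 2 * (Real.exp (θ * v 0 ^ 2) *
            Real.exp (θ' * (a + ∑ i, sgn (ε i) * v i.succ) ^ 2)) := by
          refine Finset.sum_le_sum fun ε _ => ?_
          refine le_trans (le_of_eq ?_) (sum_exp_sq_le θ (a + ∑ i, sgn (ε i) * v i.succ) (v 0))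
          refine Finset.sum_congr rfl fun b _ => ?_
          congr 2
          ring
      _ = 2 * (Real.exp (θ * v 0 ^ 2) *
            ∑ ε : Fin n → Bool, Real.exp (θ' * (a + ∑ i, sgn (ε i) * v i.succ) ^ 2)) := by
          rw [Finset.mul_sum, Finset.mul_sum]
      _ ≤ 2 * (Real.exp ((θ + 2 * M ^ 2 * (v 0 ^ 2 + V)) * v 0 ^ 2) *
            (2 ^ n * Real.exp ((θ + 2 * M ^ 2 * (v 0 ^ 2 + V)) * (a ^ 2 + V)))) := by
          gcongr
          · linarith
          · refine hih.trans ?_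
            gcongr
      _ = _ := by
          rw [mul_left_comm (Real.exp _), ← Real.exp_add]
          have : (θ + 2 * M ^ 2 * (v 0 ^ 2 + V)) * v 0 ^ 2 +
              (θ + 2 * M ^ 2 * (v 0 ^ 2 + V)) * (a ^ 2 + V) =
              (θ + 2 * M ^ 2 * (v 0 ^ 2 + V)) * (a ^ 2 + (v 0 ^ 2 + V)) := by ring
          rw [this, pow_succ]
          ring

lemma sum_exp_rademacher_sq_le_of_unit {n : ℕ} {v : Fin n → ℝ} (hv : ∑ i, v i ^ 2 = 1) {θ : ℝ}
    (hθ : |θ| ≤ 1 / 8) :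
    ∑ ε : Fin n → Bool, Real.exp (θ * (∑ i, sgn (ε i) * v i) ^ 2) ≤
      2 ^ n * Real.exp (θ + 8 * θ ^ 2) := by
  have h := sum_exp_rademacher_sq_le n v θ 0 (2 * |θ|) (by linarith [abs_nonneg θ]) (by
    rw [hv, mul_pow, sq_abs]
    nlinarith [abs_nonneg θ, le_abs_self θ, sq_abs θ])
  rw [hv, mul_pow, sq_abs] at h
  simp only [zero_add] at h
  convert! h using 3
  ring

variable {Ω : Type*} [MeasurableSpace Ω] {μ : Measure Ω} {m N : ℕ}
  {z : Ω → Fin m → EuclideanSpace ℝ (Fin N)}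

lemma IsRademacherFamily.measure_eq_sgn (hz : IsRademacherFamily μ z)
    (η : Fin m → Fin N → Bool) :
    μ.real {ω | ∀ i k, z ω i k = sgn (η i k)} = ((2 : ℝ) ^ N)⁻¹ ^ m := by
  have h := hz.indep.meas_iInter (s := fun p => {ω | z ω p.1 p.2 = sgn (η p.1 p.2)})
    fun p => ⟨{sgn (η p.1 p.2)}, measurableSet_singleton _, rfl⟩
  have e : {ω | ∀ i k, z ω i k = sgn (η i k)} =
      ⋂ p : Fin m × Fin N, {ω | z ω p.1 p.2 = sgn (η p.1 p.2)} := by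
    ext ω; simp [Prod.forall]
  have hp : ∀ p : Fin m × Fin N, μ {ω | z ω p.1 p.2 = sgn (η p.1 p.2)} = 1 / 2 := by
    intro p
    unfold sgn
    split_ifs
    exacts [hz.prob_one _ _, hz.prob_neg_one _ _]
  rw [Measure.real, e, h]
  simp only [hp, Finset.prod_const, Finset.card_univ, Fintype.card_prod, Fintype.card_fin]
  rw [ENNReal.toReal_pow]
  simp [← pow_mul, mul_comm]

variable [IsProbabilityMeasure μ]

lemma IsRademacherFamily.ae_eq_or (hz : IsRademacherFamily μ z) :
    ∀ᵐ ω ∂μ, ∀ i k, z ω i k = 1 ∨ z ω i k = -1 := by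
  rw [ae_all_iff]; intro i
  rw [ae_all_iff]; intro k
  have h1 : MeasurableSet {ω | z ω i k = 1} :=
    hz.measurable i k (measurableSet_singleton (1 : ℝ))
  have h2 : MeasurableSet {ω | z ω i k = -1} :=
    hz.measurable i k (measurableSet_singleton (-1 : ℝ))
  have hd : Disjoint {ω | z ω i k = 1} {ω | z ω i k = -1} := by
    rw [Set.disjoint_left]
    intro ω ha hb
    simp only [Set.mem_ofPred_eq] at ha hb
    linarith
  have hu : μ ({ω | z ω i k = 1} ∪ {ω | z ω i k = -1}) = 1 := by
    rw [measure_union hd h2, hz.prob_one, hz.prob_neg_one, ENNReal.add_halves]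
  have := (prob_compl_eq_zero_iff (h1.union h2)).2 hu
  exact this

/-- Markov's inequality for functions of a Rademacher family, whose law is uniform on the sign
patterns. -/
lemma IsRademacherFamily.measure_one_le_le (hz : IsRademacherFamily μ z)
    (G : (Fin m → Fin N → ℝ) → ℝ) (hG : ∀ x, 0 ≤ G x) :
    μ.real {ω | 1 ≤ G fun i k => z ω i k} ≤
      ((2 : ℝ) ^ N)⁻¹ ^ m * ∑ η : Fin m → Fin N → Bool, G fun i k => sgn (η i k) := by
  classical
  set B : Finset (Fin m → Fin N → Bool) :=
    Finset.univ.filter fun η => 1 ≤ G fun i k => sgn (η i k) with hB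
  have hsub : {ω | 1 ≤ G fun i k => z ω i k} ≤ᵐ[μ]
      (⋃ η ∈ B, {ω | ∀ i k, z ω i k = sgn (η i k)} : Set Ω) := by
    filter_upwards [hz.ae_eq_or] with ω hω hmem
    have hmem' : 1 ≤ G fun i k => z ω i k := hmem
    have hη : ∀ i k, z ω i k = sgn (decide (z ω i k = 1)) := by
      intro i k
      rcases hω i k with h | h
      · simp [sgn, h]
      · rw [h]; norm_num [sgn]
    have : ω ∈ (⋃ η ∈ B, {ω | ∀ i k, z ω i k = sgn (η i k)} : Set Ω) := by
      refine Set.mem_biUnion (x := fun i k => decide (z ω i k = 1)) ?_ hη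
      simp only [hB, Finset.coe_filter, Finset.mem_univ, true_and, Set.mem_ofPred_eq]
      simpa only [← hη] using hmem'
    exact this
  have h1 : μ.real {ω | 1 ≤ G fun i k => z ω i k} ≤
      μ.real (⋃ η ∈ B, {ω | ∀ i k, z ω i k = sgn (η i k)} : Set Ω) :=
    ENNReal.toReal_mono (measure_ne_top _ _) (measure_mono_ae hsub)
  refine h1.trans ((measureReal_biUnion_finset_le _ _).trans ?_)
  rw [Finset.mul_sum]
  refine (Finset.sum_le_sum (f := fun η : Fin m → Fin N → Bool => μ.real {ω | ∀ i k, z ω i k = sgn (η i k)})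
    (g := fun η : Fin m → Fin N → Bool => ((2 : ℝ) ^ N)⁻¹ ^ m * G fun i k => sgn (η i k)) fun η hη => ?_).trans ?_
  · rw [hz.measure_eq_sgn]
    exact le_mul_of_one_le_right (by positivity) (Finset.mem_filter.1 hη).2
  · exact Finset.sum_le_sum_of_subset_of_nonneg (Finset.subset_univ _)
      fun η _ _ => mul_nonneg (by positivity) (hG _)

/-- Chernoff's bound for the sum of the squares of `m` independent Rademacher sums; the sign of `θ`
decides between the upper and the lower tail. -/
lemma IsRademacherFamily.measure_sum_sq_le (hz : IsRademacherFamily μ z) {v : Fin N → ℝ}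
    (hv : ∑ k, v k ^ 2 = 1) {θ : ℝ} (hθ : |θ| ≤ 1 / 8) (r : ℝ) :
    μ.real {ω | m * r ≤ θ * ∑ i, (∑ k, z ω i k * v k) ^ 2} ≤
      Real.exp (m * (θ + 8 * θ ^ 2 - r)) := by
  have h := hz.measure_one_le_le (fun x => Real.exp (-(m * r)) *
    ∏ i, Real.exp (θ * (∑ k, x i k * v k) ^ 2)) (fun x => by positivity)
  have hset : {ω | m * r ≤ θ * ∑ i, (∑ k, z ω i k * v k) ^ 2} = {ω | 1 ≤ Real.exp (-(m * r)) *
      ∏ i, Real.exp (θ * (∑ k, z ω i k * v k) ^ 2)} := by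
    ext ω
    simp only [Set.mem_ofPred_eq]
    rw [← Real.exp_sum, ← Real.exp_add, Real.one_le_exp_iff, Finset.mul_sum]
    constructor <;> intro h <;> linarith
  rw [hset]
  refine h.trans ?_
  have hprod : ∑ η : Fin m → Fin N → Bool,
      ∏ i, Real.exp (θ * (∑ k, sgn (η i k) * v k) ^ 2) =
      (∑ ε : Fin N → Bool, Real.exp (θ * (∑ k, sgn (ε k) * v k) ^ 2)) ^ m := by
    rw [Finset.sum_pow', Fintype.piFinset_univ]
  rw [← Finset.mul_sum, hprod]
  have h2 := pow_le_pow_left₀ (Finset.sum_nonneg fun _ _ => (Real.exp_pos _).le)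
    (sum_exp_rademacher_sq_le_of_unit hv hθ) m
  calc _ ≤ ((2 : ℝ) ^ N)⁻¹ ^ m *
        (Real.exp (-(m * r)) * (2 ^ N * Real.exp (θ + 8 * θ ^ 2)) ^ m) := by gcongr
    _ = Real.exp (-(m * r)) * Real.exp (θ + 8 * θ ^ 2) ^ m := by
        rw [mul_pow, mul_left_comm, ← mul_assoc (_ ^ m) (_ ^ m), ← mul_pow,
          inv_mul_cancel₀ (by positivity), one_pow, one_mul]
    _ = _ := by
        rw [← Real.exp_nat_mul, ← Real.exp_add]
        congr 1
        ring

lemma norm_sampleMatrix_sq (x : Fin m → EuclideanSpace ℝ (Fin N)) (w : EuclideanSpace ℝ (Fin N)) :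
    ‖(sampleMatrix x).toEuclideanLin w‖ ^ 2 = (∑ i, (∑ k, x i k * w k) ^ 2) / m := by
  rw [EuclideanSpace.norm_sq_eq, Finset.sum_div]
  refine Finset.sum_congr rfl fun i _ => ?_
  have : ((sampleMatrix x).toEuclideanLin w) i = (∑ k, x i k * w k) / √(m : ℝ) := by
    simp only [sampleMatrix, Matrix.toLpLin_apply, Matrix.mulVec, dotProduct, Matrix.of_apply,
      Finset.sum_div]
    exact Finset.sum_congr rfl fun k _ => by ring
  rw [this, Real.norm_eq_abs, sq_abs, div_pow, Real.sq_sqrt (Nat.cast_nonneg m)]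

/-- A fixed vector nearly keeps its norm. The exponent comes from `θ = ± t / 16`, which maximises
`θ t - 8 θ²`. -/
lemma IsRademacherFamily.measure_norm_sq_defect_le (hz : IsRademacherFamily μ z) (hm : 0 < m)
    {t : ℝ} (ht0 : 0 < t) (ht : t ≤ 2) (w : EuclideanSpace ℝ (Fin N)) :
    μ.real {ω | ¬ |‖(sampleMatrix (z ω)).toEuclideanLin w‖ ^ 2 - ‖w‖ ^ 2| ≤ t * ‖w‖ ^ 2} ≤
      2 * Real.exp (-(m * (t ^ 2 / 32))) := by
  rcases eq_or_ne w 0 with rfl | hw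
  · simp only [map_zero, norm_zero]
    norm_num
    positivity
  have hw' : 0 < ‖w‖ := norm_pos_iff.2 hw
  have hm' : (0 : ℝ) < m := Nat.cast_pos.2 hm
  set v : Fin N → ℝ := fun k => w k / ‖w‖ with hv
  have hv1 : ∑ k, v k ^ 2 = 1 := by
    have h := EuclideanSpace.norm_sq_eq w
    simp only [Real.norm_eq_abs, sq_abs] at h
    simp only [hv, div_pow]
    rw [← Finset.sum_div, ← h, div_self (by positivity)]
  have hsum : ∀ ω, ‖(sampleMatrix (z ω)).toEuclideanLin w‖ ^ 2 =
      ‖w‖ ^ 2 * ((∑ i, (∑ k, z ω i k * v k) ^ 2) / m) := by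
    intro ω
    rw [norm_sampleMatrix_sq, ← mul_div_assoc, Finset.mul_sum]
    congr 1
    refine Finset.sum_congr rfl fun i _ => ?_
    rw [← mul_pow, Finset.mul_sum]
    congr 1
    refine Finset.sum_congr rfl fun k _ => ?_
    simp only [hv]
    field_simp
  have hθ : |t / 16| ≤ 1 / 8 := by rw [abs_of_pos (by positivity)]; linarith
  have h1 := hz.measure_sum_sq_le hv1 hθ (t / 16 * (1 + t))
  have h2 := hz.measure_sum_sq_le hv1 (θ := -(t / 16)) (by rwa [abs_neg]) (-(t / 16) * (1 - t))
  have hsub : {ω | ¬ |‖(sampleMatrix (z ω)).toEuclideanLin w‖ ^ 2 - ‖w‖ ^ 2| ≤ t * ‖w‖ ^ 2} ⊆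
      {ω | m * (t / 16 * (1 + t)) ≤ t / 16 * ∑ i, (∑ k, z ω i k * v k) ^ 2} ∪
      {ω | m * (-(t / 16) * (1 - t)) ≤ -(t / 16) * ∑ i, (∑ k, z ω i k * v k) ^ 2} := by
    intro ω hω
    simp only [Set.mem_ofPred_eq, Set.mem_union] at hω ⊢
    by_contra! hcon
    apply hω
    rw [hsum ω]
    set S := ∑ i, (∑ k, z ω i k * v k) ^ 2 with hS
    have ha : S / m ≤ 1 + t := by
      rw [div_le_iff₀ hm']
      nlinarith [hcon.1]
    have hb : 1 - t ≤ S / m := by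
      rw [le_div_iff₀ hm']
      nlinarith [hcon.2]
    have hw2 : 0 < ‖w‖ ^ 2 := by positivity
    rw [abs_le]
    constructor <;> nlinarith
  have e1 : m * (t / 16 + 8 * (t / 16) ^ 2 - t / 16 * (1 + t)) = -(m * (t ^ 2 / 32)) := by ring
  have e2 : m * (-(t / 16) + 8 * (-(t / 16)) ^ 2 - -(t / 16) * (1 - t)) =
      -(m * (t ^ 2 / 32)) := by ring
  rw [e1] at h1
  rw [e2] at h2
  refine (measureReal_mono hsub).trans ((measureReal_union_le _ _).trans ?_)
  linarith

/-- Rademacher matrices with `m` rows have the restricted isometry property of order `4 s` on an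
event that is large once `m` is a large multiple of `s log N`. -/
lemma IsRademacherFamily.exists_restrictedIsometry (hz : IsRademacherFamily μ z) (hm : 0 < m)
    (hN : 0 < N) (s : ℕ) :
    ∃ A : Set Ω, MeasurableSet A ∧
      1 - 4 * (25 * N : ℝ) ^ (4 * s) * Real.exp (-(m / 51200)) ≤ μ.real A ∧
      ∀ ω ∈ A, RestrictedIsometry (sampleMatrix (z ω)) (4 * s) (1 / 10) := by
  obtain ⟨W, hcard, hW⟩ := exists_test_vectors hN (4 * s)
  have hmeas : ∀ w, MeasurableSet {ω | |‖(sampleMatrix (z ω)).toEuclideanLin w‖ ^ 2 -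
      ‖w‖ ^ 2| ≤ 1 / 40 * ‖w‖ ^ 2} := by
    intro w
    simp only [norm_sampleMatrix_sq]
    refine measurableSet_le ?_ measurable_const
    have h := hz.measurable
    refine ((Measurable.div_const (Finset.measurable_sum _ fun i _ =>
      (Finset.measurable_sum _ fun k _ => (h i k).mul_const _).pow_const 2) _).sub_const _).abs
  set A : Set Ω := ⋂ w ∈ W, {ω | |‖(sampleMatrix (z ω)).toEuclideanLin w‖ ^ 2 -
      ‖w‖ ^ 2| ≤ 1 / 40 * ‖w‖ ^ 2} with hA
  have hAm : MeasurableSet A := W.measurableSet_biInter fun w _ => hmeas w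
  refine ⟨A, hAm, ?_, fun ω hω => ?_⟩
  · have hcompl : Aᶜ ⊆ ⋃ w ∈ W, {ω | ¬ |‖(sampleMatrix (z ω)).toEuclideanLin w‖ ^ 2 -
        ‖w‖ ^ 2| ≤ 1 / 40 * ‖w‖ ^ 2} := by
      rw [hA, Set.compl_iInter₂]
      rfl
    have h1 : μ.real Aᶜ ≤ W.card * (2 * Real.exp (-(m * ((1 / 40) ^ 2 / 32)))) := by
      refine (measureReal_mono hcompl (measure_ne_top _ _)).trans ((measureReal_biUnion_finset_le _ _).trans ?_)
      refine (Finset.sum_le_card_nsmul _ _ _ fun w _ =>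
        hz.measure_norm_sq_defect_le hm (by norm_num) (by norm_num) w).trans ?_
      rw [nsmul_eq_mul]
    have h2 : (W.card : ℝ) ≤ 2 * (25 * N) ^ (4 * s) := by exact_mod_cast hcard
    have h3 : (m : ℝ) * ((1 / 40) ^ 2 / 32) = m / 51200 := by ring
    rw [h3] at h1
    rw [measureReal_compl hAm, probReal_univ] at h1
    have h4 := mul_le_mul_of_nonneg_right h2 (Real.exp_pos (-((m : ℝ) / 51200))).le
    linarith
  · have := hW m (sampleMatrix (z ω)) (1 / 40) (by norm_num) (by simpa [hA] using hω)
    norm_num at this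
    exact this

end Concentration

/-! ### Accuracy of the block gradient estimator -/

section Estimator

variable {d J N m : ℕ} {e : Fin J × Fin N ≃ Fin d} {j : Fin J}

lemma l0_blockGradient_le (f : EuclideanSpace ℝ (Fin d) → ℝ) (x : EuclideanSpace ℝ (Fin d)) :
    l0 (blockGradient e f j x) ≤ l0 (∇ f x) := by
  refine Finset.card_le_card_of_injOn (fun k => e (j, k)) (fun k hk => ?_) fun k _ l _ h => ?_
  · have : (∇ f x) (e (j, k)) ≠ 0 := (Finset.mem_filter.1 (Finset.mem_coe.1 hk)).2
    simp [supp, this]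
  · simpa using h

/-- The measurements are those of the block gradient, up to an error made of the Taylor remainder
and of the oracle noise. At `δ = 2 √(σ / H)` both parts equal `√(σ H)`. -/
lemma norm_measurements_sub_le {X : Set (EuclideanSpace ℝ (Fin d))}
    {f : EuclideanSpace ℝ (Fin d) → ℝ} {H σ : ℝ} (hf : WeaklySparseBlockHessian e X f H)
    (hH : 0 < H) (hσ : 0 < σ) {x : EuclideanSpace ℝ (Fin d)}
    {z : Fin m → EuclideanSpace ℝ (Fin N)} (hz : ∀ i k, z i k = 1 ∨ z i k = -1)
    (hX : ∀ i, segment ℝ x (x + (2 * √(σ / H)) • embed e j (z i)) ⊆ X)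
    {ξ ξ' : Fin m → ℝ} (hξ : ∀ i, |ξ i| ≤ σ) (hξ' : ∀ i, |ξ' i| ≤ σ) :
    ‖measurements e f j x (2 * √(σ / H)) z ξ ξ' -
      (sampleMatrix z).toEuclideanLin (blockGradient e f j x)‖ ≤ 2 * √(σ * H) := by
  set δ := 2 * √(σ / H) with hδdef
  have hδ : 0 < δ := by positivity
  have hδsq : H * δ ^ 2 = 4 * σ := by
    rw [hδdef, mul_pow, Real.sq_sqrt (by positivity)]
    field_simp
    norm_num
  have hδH : √(σ * H) * δ = 2 * σ := by
    rw [hδdef, mul_left_comm, ← Real.sqrt_mul (by positivity),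
      show σ * H * (σ / H) = σ ^ 2 by field_simp, Real.sqrt_sq hσ.le]
  have hentry : ∀ i, ‖(measurements e f j x δ z ξ ξ' -
      (sampleMatrix z).toEuclideanLin (blockGradient e f j x)) i‖ ^ 2 ≤
      (2 * √(σ * H)) ^ 2 / m := by
    intro i
    have h1 := hf.abs_sub_sub_le hδ.le (hz i) (hX i)
    set S := ∑ k, z i k * blockGradient e f j x k with hS
    have hm : (0 : ℝ) < m := Nat.cast_pos.2 (Fin.pos i)
    have h2 : ((sampleMatrix z).toEuclideanLin (blockGradient e f j x)) i = S / √(m : ℝ) := by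
      simp only [sampleMatrix, Matrix.toLpLin_apply, Matrix.mulVec, dotProduct, Matrix.of_apply,
        hS, Finset.sum_div]
      exact Finset.sum_congr rfl fun k _ => by ring
    have h3 : (measurements e f j x δ z ξ ξ' -
        (sampleMatrix z).toEuclideanLin (blockGradient e f j x)) i =
        (f (x + δ • embed e j (z i)) - f x - δ * S + (ξ i - ξ' i)) / δ / √(m : ℝ) := by
      rw [PiLp.sub_apply, h2]
      simp only [measurements]
      field_simp
      ring
    have h4 : |(f (x + δ • embed e j (z i)) - f x - δ * S + (ξ i - ξ' i)) / δ| ≤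
        2 * √(σ * H) := by
      rw [abs_div, abs_of_pos hδ, div_le_iff₀ hδ]
      have h5 := abs_add_le (f (x + δ • embed e j (z i)) - f x - δ * S) (ξ i - ξ' i)
      have h6 := abs_sub (ξ i) (ξ' i)
      have h7 := hξ i
      have h8 := hξ' i
      linarith
    rw [h3, Real.norm_eq_abs, sq_abs, div_pow, Real.sq_sqrt hm.le]
    gcongr ?_ / _
    exact sq_le_sq' (abs_le.1 h4).1 (abs_le.1 h4).2
  refine (sq_le_sq₀ (norm_nonneg _) (by positivity)).1 ?_
  rw [EuclideanSpace.norm_sq_eq]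
  refine (Finset.sum_le_sum fun i _ => hentry i).trans ?_
  rw [Finset.sum_const, Finset.card_univ, Fintype.card_fin, nsmul_eq_mul]
  rcases Nat.eq_zero_or_pos m with rfl | hm
  · simp only [CharP.cast_eq_zero, zero_mul]; positivity
  · exact (mul_div_cancel₀ _ (Nat.cast_pos.2 hm).ne').le

/-- The failure probability of the restricted isometry property is below `(s / d) ^ (b₂ s)`. All
factors are powers of `N = d / J ≥ 2`: `4 (25 N) ^ (4 s) ≤ N ^ (26 s)`, and half of the exponent
`b₁ s log N / 51200` absorbs the latter. -/
lemma failure_bound {s : ℕ} (hs : 0 < s) (hd : 0 < d) (hN : 2 ≤ N) {b₁ b₂ : ℝ}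
    (hb₁ : 52 * 51200 ≤ b₁)
    (hb : b₂ * Real.log (d / s) ≤ 1 / (2 * 51200) * b₁ * Real.log N)
    (hm : b₁ * s * Real.log N ≤ m) :
    4 * (25 * N : ℝ) ^ (4 * s) * Real.exp (-(m / 51200)) ≤ ((s : ℝ) / d) ^ (b₂ * s) := by
  have hN' : (0 : ℝ) < N := by positivity
  have hs' : (0 : ℝ) < s := Nat.cast_pos.2 hs
  have hd' : (0 : ℝ) < d := Nat.cast_pos.2 hd
  have hlog : 0 < Real.log N := Real.log_pos (by exact_mod_cast hN)
  have h1 : 4 * (25 * N : ℝ) ^ (4 * s) ≤ (N : ℝ) ^ (26 * s) := by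
    have h2 : 4 * (25 * N) ^ (4 * s) ≤ N ^ (26 * s) := by
      calc 4 * (25 * N) ^ (4 * s) ≤ N ^ (2 * s) * (N ^ 6) ^ (4 * s) := by
            gcongr
            · calc 4 = 2 ^ 2 := by norm_num
                _ ≤ N ^ 2 := Nat.pow_le_pow_left hN 2
                _ ≤ N ^ (2 * s) := Nat.pow_le_pow_right (by omega) (by omega)
            · calc 25 * N ≤ 2 ^ 5 * N := by omega
                _ ≤ N ^ 5 * N := Nat.mul_le_mul_right _ (Nat.pow_le_pow_left hN 5)
                _ = N ^ 6 := by ring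
        _ = N ^ (26 * s) := by rw [← pow_mul, ← pow_add]; congr 1; omega
    exact_mod_cast h2
  have h3 : (N : ℝ) ^ (26 * s) = Real.exp (26 * s * Real.log N) := by
    rw [mul_comm (26 * (s : ℝ)), Real.exp_mul, Real.exp_log hN', ← Real.rpow_natCast]
    push_cast
    rfl
  have h4 : ((s : ℝ) / d) ^ (b₂ * s) = Real.exp (-(s * (b₂ * Real.log (d / s)))) := by
    rw [Real.rpow_def_of_pos (by positivity), ← inv_div, Real.log_inv]
    congr 1
    ring
  calc 4 * (25 * N : ℝ) ^ (4 * s) * Real.exp (-(m / 51200))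
      ≤ Real.exp (26 * s * Real.log N) * Real.exp (-(m / 51200)) := by
        rw [← h3]; gcongr
    _ = Real.exp (26 * s * Real.log N - m / 51200) := by rw [← Real.exp_add, sub_eq_add_neg]
    _ ≤ Real.exp (-(s * (b₂ * Real.log (d / s)))) := by
        refine Real.exp_le_exp.2 ?_
        have h5 := mul_le_mul_of_nonneg_left hb hs'.le
        have h6 := mul_le_mul_of_nonneg_right hb₁ (mul_pos hs' hlog).le
        linarith
    _ = _ := h4.symm

end Estimator

end BlockGrad

end

theorem theorem2p1 :
    ∃ ρ τ b₀ c : ℝ, 0 < ρ ∧ ρ < 1 ∧ 0 < τ ∧ 0 < b₀ ∧ 0 < c ∧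
    ∀ (d J N : ℕ) (e : Fin J × Fin N ≃ Fin d) (_hJd : J < d)
      (X : Set (EuclideanSpace ℝ (Fin d))) (f : EuclideanSpace ℝ (Fin d) → ℝ)
      (L : Fin J → ℝ) (sExact : ℕ) (H : ℝ) (_hH : 0 < H)
      (_hLip : BlockGrad.BlockLipschitz e X f L)
      (_hSparse : BlockGrad.SparseGradients f sExact)
      (_hHess : BlockGrad.WeaklySparseBlockHessian e X f H)
      (σ : ℝ) (_hσ : 0 < σ) (δ : ℝ) (_hδ : δ = 2 * √(σ / H))
      (s : ℕ) (_hs : sExact ≤ s)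
      (b₁ b₂ : ℝ) (_hb₁ : b₀ ≤ b₁) (_hb₂ : 0 < b₂)
      (_hb₁₂ : b₂ * Real.log (d / s) ≤ c * b₁ * Real.log (d / J))
      (m : ℕ) (_hm : m = ⌈b₁ * s * Real.log (d / J)⌉₊)
      (n : ℕ) (j : Fin J) (x : EuclideanSpace ℝ (Fin d))
      -- the segments from `x` to all possible query points lie in the domain `X`
      (_hX : ∀ ε : EuclideanSpace ℝ (Fin N), (∀ k, ε k = 1 ∨ ε k = -1) →
        segment ℝ x (x + δ • BlockGrad.embed e j ε) ⊆ X)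
      {Ω : Type*} [MeasurableSpace Ω] (μ : Measure Ω) [IsProbabilityMeasure μ]
      (z : Ω → Fin m → EuclideanSpace ℝ (Fin N)) (_hz : BlockGrad.IsRademacherFamily μ z)
      -- bounded oracle noise, possibly dependent on everything else
      (ξ ξ' : Ω → Fin m → ℝ)
      (_hξ : ∀ i, ∀ᵐ ω ∂μ, |ξ ω i| ≤ σ) (_hξ' : ∀ i, ∀ᵐ ω ∂μ, |ξ' ω i| ≤ σ),
      ∃ A : Set Ω, MeasurableSet A ∧
        1 - ((s : ℝ) / d) ^ (b₂ * s) ≤ μ.real A ∧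
        ∀ ω ∈ A, ∀ g : EuclideanSpace ℝ (Fin N),
          BlockGrad.IsBlockGradientEstimate e f j x s δ n (z ω) (ξ ω) (ξ' ω) g →
            ‖g - BlockGrad.blockGradient e f j x‖ ≤
              ρ ^ n * ‖BlockGrad.blockGradient e f j x‖ + 2 * τ * √(σ * H) := by
  refine ⟨1 / 2, 14, 52 * 51200, 1 / (2 * 51200), by norm_num, by norm_num, by norm_num,
    by norm_num, by norm_num, ?_⟩
  intro d J N e hJd X f L sExact H hH _ hSparse hHess σ hσ δ hδ s hs b₁ b₂ hb₁ hb₂ hb₁₂ m hm n j x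
    hX Ω _ μ _ z hz ξ ξ' hξ hξ'
  subst hδ
  have hs0 : 0 < s := hSparse.1.trans_le hs
  have hd0 : 0 < d := by omega
  -- for `s ≥ d` the claimed probability is at most zero
  rcases le_or_gt d s with hds | -
  · refine ⟨∅, MeasurableSet.empty, ?_, by simp⟩
    have h1 : (1 : ℝ) ≤ (s : ℝ) / d := by
      rw [one_le_div (Nat.cast_pos.2 hd0)]
      exact_mod_cast hds
    have := Real.one_le_rpow h1 (by positivity : (0 : ℝ) ≤ b₂ * s)
    simp only [measureReal_empty]
    linarith
  have hcard : d = J * N := by simpa using (Fintype.card_congr e).symm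
  have hJ : 0 < J := Fin.pos j
  have hN : 2 ≤ N := by
    by_contra! h
    have := Nat.mul_le_mul_left J (Nat.le_of_lt_succ h)
    omega
  have hdJ : (d : ℝ) / J = N := by
    rw [hcard, Nat.cast_mul, mul_div_cancel_left₀ _ (Nat.cast_pos.2 hJ).ne']
  rw [hdJ] at hb₁₂ hm
  have hm1 : b₁ * s * Real.log N ≤ m := hm ▸ Nat.le_ceil _
  have hb₁0 : 0 < b₁ := by linarith
  have hlog : 0 < Real.log N := Real.log_pos (by exact_mod_cast hN)
  have hs' : (0 : ℝ) < s := Nat.cast_pos.2 hs0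
  have hm0 : 0 < m := by
    have : (0 : ℝ) < m := lt_of_lt_of_le (by positivity) hm1
    exact_mod_cast this
  obtain ⟨A, hAm, hA, hRIP⟩ := hz.exists_restrictedIsometry hm0 (by omega : 0 < N) s
  -- the noises need not be measurable, so the almost sure bounds are placed on a measurable set
  obtain ⟨B, hB, hBm, hBprop⟩ :=
    (hz.ae_eq_or.and ((ae_all_iff.2 hξ).and (ae_all_iff.2 hξ'))).exists_measurable_mem
  refine ⟨A ∩ B, hAm.inter hBm, ?_, ?_⟩
  · have h1 : μ.real A ≤ μ.real (A ∩ B) := by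
      refine ENNReal.toReal_mono (measure_ne_top _ _) (measure_mono_ae ?_)
      filter_upwards [hB] with ω hω hωA
      exact ⟨hωA, hω⟩
    have h2 := BlockGrad.failure_bound hs0 hd0 hN hb₁ hb₁₂ hm1
    linarith
  · rintro ω ⟨hωA, hωB⟩ g hg
    obtain ⟨hsign, hn, hn'⟩ := hBprop ω hωB
    have h1 := BlockGrad.IsCoSaMPOutput.norm_sub_le (hRIP ω hωA)
      ((BlockGrad.l0_blockGradient_le (e := e) (j := j) f x).trans ((hSparse.2.2 x).trans hs)) hg
    have h2 := BlockGrad.norm_measurements_sub_le hHess hH hσ hsign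
      (fun i => hX (z ω i) (hsign i)) hn hn'
    linarith
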